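/- Let $c_1,c_2,\lambda>0$. Let $\{N(t)\}_{t\ge 0}$ be a homogeneous Poisson process with rate $\lambda$, and let $V(0)$ be a random variable, independent of it, with $P\{V(0)=c_1\}=P\{V(0)=-c_2\}=\tfrac12$. Let $V(t)$ be the velocity which starts from $V(0)$ and switches between $c_1$ and $-c_2$ at every event of the Poisson process, and let $\mathcal T(t)=\int_0^t V(s)\,ds$, $t\ge 0$, be the corresponding asymmetric telegraph process. Then for every $t>0$, every integer $k\ge 0$ and every $\beta\in[0,c_1t]$, $$P\Bigl\{\max_{0\le s\le t}\mathcal T(s)<\beta\ \Big|\ V(0)=c_1,\ N(t)=2k+1\Bigr\}=\sum_{j=0}^{k}\binom{2k+1}{j}\,\frac{(c_1t-\beta)^j(c_2t+\beta)^{2k+1-j}-\bigl(\tfrac{c_2}{c_1}\bigr)^{2k+1-2j}(c_1t-\beta)^{2k+1-j}(c_2t+\beta)^j}{\bigl[(c_1+c_2)t\bigr]^{2k+1}}.$$ -/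

import Mathlib

open MeasureTheory ProbabilityTheory

namespace Telegraph

noncomputable section

variable {Ω : Type*}

/-- The instant of the `(n+1)`-st Poisson event, `T_{n+1} = ξ₀ + ξ₁ + ⋯ + ξₙ`, where `ξ` is the
sequence of waiting times between consecutive events. -/
def eventTime (ξ : ℕ → Ω → ℝ) (n : ℕ) (ω : Ω) : ℝ :=
  ∑ i ∈ Finset.range (n + 1), ξ i ω

/-- The counting process `N(t)`: the number of events in `[0, t]`. -/
def count (ξ : ℕ → Ω → ℝ) (t : ℝ) (ω : Ω) : ℕ :=
  Set.ncard {n : ℕ | eventTime ξ n ω ≤ t}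

/-- The velocity `V(t)`: it starts from `V(0) = V₀` and switches between `c₁` and `-c₂` at each
event of the counting process. -/
def velocity (c₁ c₂ : ℝ) (V₀ : Ω → ℝ) (ξ : ℕ → Ω → ℝ) (t : ℝ) (ω : Ω) : ℝ :=
  if Even (count ξ t ω) then V₀ ω else (if V₀ ω = c₁ then -c₂ else c₁)

/-- The position `𝒯(t) = ∫₀ᵗ V(s) ds` of the particle started at the origin. -/
def position (c₁ c₂ : ℝ) (V₀ : Ω → ℝ) (ξ : ℕ → Ω → ℝ) (t : ℝ) (ω : Ω) : ℝ :=
  ∫ s in (0 : ℝ)..t, velocity c₁ c₂ V₀ ξ s ω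

/-- The maximum of the position over the time interval `[0, t]`. It is attained, see
`isGreatest_maxPosition`. -/
def maxPosition (c₁ c₂ : ℝ) (V₀ : Ω → ℝ) (ξ : ℕ → Ω → ℝ) (t : ℝ) (ω : Ω) : ℝ :=
  sSup ((fun s => position c₁ c₂ V₀ ξ s ω) '' Set.Icc 0 t)

/-- The random input of the asymmetric telegraph process with velocities `c₁`, `-c₂` and switching
rate `lam`: the initial velocity is `c₁` or `-c₂` with equal probability, and it is independent of
the driving homogeneous Poisson process, whose waiting times are independent and exponentially
distributed with rate `lam`. -/
structure IsTelegraphInput [MeasurableSpace Ω] (c₁ c₂ lam : ℝ) (P : Measure Ω)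
    (V₀ : Ω → ℝ) (ξ : ℕ → Ω → ℝ) : Prop where
  measurable_velocity : Measurable V₀
  prob_right : P {ω | V₀ ω = c₁} = 1 / 2
  prob_left : P {ω | V₀ ω = -c₂} = 1 / 2
  measurable_waiting : ∀ n, Measurable (ξ n)
  law_waiting : ∀ n, P.map (ξ n) = expMeasure lam
  indep_waiting : iIndepFun ξ P
  indep_velocity : IndepFun V₀ (fun ω n => ξ n ω) P

theorem measurable_velocity_time (c₁ c₂ : ℝ) (V₀ : Ω → ℝ) (ξ : ℕ → Ω → ℝ) (ω : Ω) :
    Measurable (fun s => velocity c₁ c₂ V₀ ξ s ω) := by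
  have h : Measurable (fun s => count ξ s ω) := by
    refine measurable_ncard.comp (measurable_set_iff.2 fun n => ?_)
    exact measurableSet_setOfPred.1 (measurableSet_Ici (a := eventTime ξ n ω))
  have h2 : MeasurableSet {s | Even (count ξ s ω)} :=
    h (MeasurableSet.of_discrete (s := {m : ℕ | Even m}))
  exact Measurable.ite h2 measurable_const measurable_const

theorem continuous_position (c₁ c₂ : ℝ) (V₀ : Ω → ℝ) (ξ : ℕ → Ω → ℝ) (ω : Ω) :
    Continuous (fun s => position c₁ c₂ V₀ ξ s ω) := by
  refine intervalIntegral.continuous_primitive (fun a b => ?_) 0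
  rw [intervalIntegrable_iff]
  refine Measure.integrableOn_of_bounded (M := |V₀ ω| + |c₁| + |c₂|) (by simp)
    (measurable_velocity_time c₁ c₂ V₀ ξ ω).aestronglyMeasurable
    (Filter.Eventually.of_forall fun s => ?_)
  have h0 := abs_nonneg (V₀ ω)
  have h1 := abs_nonneg c₁
  have h2 := abs_nonneg c₂
  rw [Real.norm_eq_abs, velocity]
  split_ifs <;> (try rw [abs_neg]) <;> linarith

theorem isGreatest_maxPosition (c₁ c₂ : ℝ) (V₀ : Ω → ℝ) (ξ : ℕ → Ω → ℝ) {t : ℝ} (ht : 0 ≤ t)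
    (ω : Ω) :
    IsGreatest ((fun s => position c₁ c₂ V₀ ξ s ω) '' Set.Icc 0 t)
      (maxPosition c₁ c₂ V₀ ξ t ω) := by
  have hc : IsCompact ((fun s => position c₁ c₂ V₀ ξ s ω) '' Set.Icc 0 t) :=
    isCompact_Icc.image (continuous_position c₁ c₂ V₀ ξ ω)
  exact hc.isGreatest_sSup ((Set.nonempty_Icc.2 ht).image _)

end

end Telegraph

/-! Let `t` be the remaining time, `β` the remaining distance to the level, `ρ = c₂/c₁`, and use the
coordinates `x = c₁t - β`, `y = c₂t + β`. A stretch of length `s` at velocity `c₁` keeps `x` and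
lowers `y` by `(c₁ + c₂)s`; at velocity `-c₂` it keeps `y` and lowers `x` by the same amount.
Conditioning on the first waiting time (`real_turnsBelow_succ`) therefore expresses the probability
of `m` turns below the level as iterated integrals, alternately in `y` and `x`. The exponential
densities only contribute `lam ^ m * exp (-(lam * t))`, so what remains is a volume.

The volumes are polynomials: `oddPoly` is an antiderivative of `evenPoly` in `y`, and the next
`evenPoly` is one of `oddPoly` in `x`. The constant of integration comes from the level. When `x >
0`, a first stretch at `c₁` must end before `β` is reached, that is, before `y = ρx`, and `oddPoly`
vanishes on that line: its subtracted terms are the images of the others under the oblique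
reflection `(x, y) ↦ (y/ρ, ρx)`. For `x ≤ 0` the level is out of reach and the volume is a divided
power of `x + y`. A level above `c₁t` gives the probability of the conditioning event, and the
theorem is the quotient. -/

namespace Telegraph

noncomputable section

variable {Ω : Type*}

/-! ### Paths: renewal at the first turn. -/

/-- A particle that starts with velocity `v` and alternates between the velocities `v` and `w`,
with waiting times `x 0, x 1, …`, makes exactly `m` turns up to time `t` and its positions at the
turns and at time `t` at the end of a stretch with velocity `v` are below `β`. -/
def TurnsBelow : ℝ → ℝ → ℕ → ℝ → ℝ → (ℕ → ℝ) → Prop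
  | v, _, 0, t, β, x => t < x 0 ∧ v * t < β
  | v, w, m + 1, t, β, x =>
    x 0 ≤ t ∧ v * x 0 < β ∧ TurnsBelow w v m (t - x 0) (β - v * x 0) (fun n => x (n + 1))

theorem intervalIntegrable_velocity (c₁ c₂ : ℝ) (V₀ : Ω → ℝ) (ξ : ℕ → Ω → ℝ) (ω : Ω) (a b : ℝ) :
    IntervalIntegrable (fun s => velocity c₁ c₂ V₀ ξ s ω) volume a b := by
  rw [intervalIntegrable_iff]
  refine Measure.integrableOn_of_bounded (M := |V₀ ω| + |c₁| + |c₂|) (by simp)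
    (measurable_velocity_time c₁ c₂ V₀ ξ ω).aestronglyMeasurable
    (Filter.Eventually.of_forall fun s => ?_)
  have h0 := abs_nonneg (V₀ ω)
  have h1 := abs_nonneg c₁
  have h2 := abs_nonneg c₂
  rw [Real.norm_eq_abs, velocity]
  split_ifs <;> (try rw [abs_neg]) <;> linarith

/-- The two velocities are `c₁` and `-c₂`, in either order. -/
def IsVelocityPair (c₁ c₂ v w : ℝ) : Prop :=
  (v = c₁ ∧ w = -c₂) ∨ (v = -c₂ ∧ w = c₁)

theorem IsVelocityPair.symm {c₁ c₂ v w : ℝ} (h : IsVelocityPair c₁ c₂ v w) :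
    IsVelocityPair c₁ c₂ w v := by
  rcases h with ⟨h, h'⟩ | ⟨h, h'⟩
  exacts [Or.inr ⟨h', h⟩, Or.inl ⟨h', h⟩]

theorem velocity_eq {c₁ c₂ v w : ℝ} (hc₁ : 0 < c₁) (hc₂ : 0 < c₂)
    (h : IsVelocityPair c₁ c₂ v w) {V₀ : Ω → ℝ} {ω : Ω} (hV : V₀ ω = v) (ξ : ℕ → Ω → ℝ) (s : ℝ) :
    velocity c₁ c₂ V₀ ξ s ω = if Even (count ξ s ω) then v else w := by
  rw [velocity, hV]
  rcases h with ⟨rfl, rfl⟩ | ⟨rfl, rfl⟩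
  · simp
  · rw [if_neg (by linarith : ¬ (-c₂ = w))]

theorem eventTime_zero (ξ : ℕ → Ω → ℝ) (ω : Ω) : eventTime ξ 0 ω = ξ 0 ω := by
  simp [eventTime]

theorem eventTime_succ (ξ : ℕ → Ω → ℝ) (n : ℕ) (ω : Ω) :
    eventTime ξ (n + 1) ω = ξ 0 ω + eventTime (fun i => ξ (i + 1)) n ω := by
  rw [eventTime, Finset.sum_range_succ', add_comm]
  rfl

theorem le_eventTime {ξ : ℕ → Ω → ℝ} {ω : Ω} (hξ : ∀ n, 0 ≤ ξ n ω) (n : ℕ) :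
    ξ 0 ω ≤ eventTime ξ n ω :=
  Finset.single_le_sum (f := fun i => ξ i ω) (fun i _ => hξ i) (by simp)

theorem events_eq_empty {ξ : ℕ → Ω → ℝ} {ω : Ω} (hξ : ∀ n, 0 ≤ ξ n ω) {s : ℝ} (hs : s < ξ 0 ω) :
    {n | eventTime ξ n ω ≤ s} = ∅ := by
  ext n
  simpa using hs.trans_le (le_eventTime hξ n)

theorem count_eq_zero {ξ : ℕ → Ω → ℝ} {ω : Ω} (hξ : ∀ n, 0 ≤ ξ n ω) {s : ℝ} (hs : s < ξ 0 ω) :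
    count ξ s ω = 0 := by
  rw [count, events_eq_empty hξ hs, Set.ncard_empty]

/-- With `encard` the recursion needs no finiteness; with `ncard`, hence `count`, it fails for
infinitely many events, whose `ncard` is `0`. -/
theorem encard_events_shift (ξ : ℕ → Ω → ℝ) (ω : Ω) {s : ℝ} (hs : ξ 0 ω ≤ s) :
    {n | eventTime ξ n ω ≤ s}.encard =
      {n | eventTime (fun i => ξ (i + 1)) n ω ≤ s - ξ 0 ω}.encard + 1 := by
  have h : {n | eventTime ξ n ω ≤ s} =
      insert 0 (Nat.succ '' {n | eventTime (fun i => ξ (i + 1)) n ω ≤ s - ξ 0 ω}) := by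
    ext n
    cases n with
    | zero => simpa [eventTime_zero] using hs
    | succ n => simp [eventTime_succ, le_sub_iff_add_le']
  rw [h, Set.encard_insert_of_notMem (by simp), Nat.succ_injective.encard_image]

theorem even_count_shift (ξ : ℕ → Ω → ℝ) (ω : Ω) {s : ℝ} (hs : ξ 0 ω ≤ s)
    (hfin : {n | eventTime ξ n ω ≤ s}.Finite) :
    Even (count ξ s ω) ↔ ¬ Even (count (fun i => ξ (i + 1)) (s - ξ 0 ω) ω) := by
  have h := encard_events_shift ξ ω hs
  have hfin' : {n | eventTime (fun i => ξ (i + 1)) n ω ≤ s - ξ 0 ω}.Finite := by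
    rw [← Set.encard_lt_top_iff] at hfin ⊢
    rw [h] at hfin
    exact lt_of_le_of_lt le_self_add hfin
  rw [← hfin.cast_ncard_eq, ← hfin'.cast_ncard_eq] at h
  have h' : count ξ s ω = count (fun i => ξ (i + 1)) (s - ξ 0 ω) ω + 1 := by exact_mod_cast h
  rw [h', Nat.even_add_one]

theorem position_of_le {c₁ c₂ : ℝ} {V₀ : Ω → ℝ} {ξ : ℕ → Ω → ℝ} {ω : Ω}
    (hξ : ∀ n, 0 ≤ ξ n ω) {s : ℝ} (h0 : 0 ≤ s) (hs : s ≤ ξ 0 ω) :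
    position c₁ c₂ V₀ ξ s ω = V₀ ω * s := by
  have h : position c₁ c₂ V₀ ξ s ω = ∫ _ in (0 : ℝ)..s, V₀ ω := by
    refine intervalIntegral.integral_congr_Ioo_of_le h0 fun u hu => ?_
    simp [velocity, count_eq_zero hξ (hu.2.trans_le hs)]
  rw [h]
  simp [mul_comm]

theorem position_shift {c₁ c₂ v w : ℝ} (hc₁ : 0 < c₁) (hc₂ : 0 < c₂)
    (h : IsVelocityPair c₁ c₂ v w) {V₀ : Ω → ℝ} {ξ : ℕ → Ω → ℝ} {ω : Ω} (hV : V₀ ω = v)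
    (hξ : ∀ n, 0 ≤ ξ n ω) {s : ℝ} (hs : ξ 0 ω ≤ s)
    (hfin : {n | eventTime ξ n ω ≤ s}.Finite) :
    position c₁ c₂ V₀ ξ s ω = v * ξ 0 ω +
      position c₁ c₂ (fun _ => w) (fun i => ξ (i + 1)) (s - ξ 0 ω) ω := by
  rw [position, ← intervalIntegral.integral_add_adjacent_intervals
    (intervalIntegrable_velocity c₁ c₂ V₀ ξ ω 0 (ξ 0 ω)) (intervalIntegrable_velocity _ _ _ _ _ _ _)]
  congr 1
  · exact (position_of_le hξ (hξ 0) le_rfl).trans (by rw [hV])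
  · have e := intervalIntegral.integral_comp_sub_right (a := ξ 0 ω) (b := s)
      (fun u => velocity c₁ c₂ (fun _ => w) (fun i => ξ (i + 1)) u ω) (ξ 0 ω)
    rw [sub_self] at e
    rw [position, ← e]
    refine intervalIntegral.integral_congr fun u hu => ?_
    rw [Set.uIcc_of_le hs] at hu
    have hf : {n | eventTime ξ n ω ≤ u}.Finite := hfin.subset fun n hn => le_trans hn hu.2
    simp only [velocity_eq hc₁ hc₂ h hV, 
      velocity_eq hc₁ hc₂ h.symm (V₀ := fun _ : Ω => w) (ω := ω) rfl,
      even_count_shift ξ ω hu.1 hf]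
    split_ifs <;> simp_all

/-- The path is linear on a stretch and starts below the level, so only the endpoint matters,
whatever the sign of `v`. -/
theorem forall_mul_lt_iff {v a β : ℝ} (hβ : 0 < β) (ha : 0 ≤ a) :
    (∀ s ∈ Set.Icc 0 a, v * s < β) ↔ v * a < β := by
  refine ⟨fun h => h a ⟨ha, le_rfl⟩, fun h s hs => ?_⟩
  rcases le_total v 0 with hv | hv
  · exact (mul_nonpos_of_nonpos_of_nonneg hv hs.1).trans_lt hβ
  · exact (mul_le_mul_of_nonneg_left hs.2 hv).trans_lt h

/-- After the first turn the path restarts from the origin with the velocities exchanged, time `t -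
ξ 0 ω` and level `β - v * ξ 0 ω`, which is the recursion in `TurnsBelow`. -/
theorem turnsBelow_iff {c₁ c₂ : ℝ} (hc₁ : 0 < c₁) (hc₂ : 0 < c₂) (m : ℕ) {v w : ℝ}
    (h : IsVelocityPair c₁ c₂ v w) {V₀ : Ω → ℝ} {ξ : ℕ → Ω → ℝ} {ω : Ω} (hV : V₀ ω = v)
    (hξ : ∀ n, 0 ≤ ξ n ω) {t β : ℝ} (ht : 0 ≤ t) (hβ : 0 < β) :
    ({n | eventTime ξ n ω ≤ t}.encard = m ∧
        ∀ s ∈ Set.Icc 0 t, position c₁ c₂ V₀ ξ s ω < β) ↔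
      TurnsBelow v w m t β (fun n => ξ n ω) := by
  induction m generalizing v w V₀ ξ t β with
  | zero =>
    rw [TurnsBelow]
    have he : {n | eventTime ξ n ω ≤ t}.encard = ((0 : ℕ) : ℕ∞) ↔ t < ξ 0 ω := by
      rw [Nat.cast_zero, Set.encard_eq_zero]
      refine ⟨fun h => ?_, events_eq_empty hξ⟩
      by_contra hn
      have : (0 : ℕ) ∈ {n | eventTime ξ n ω ≤ t} := by
        simpa [eventTime_zero] using hn
      simp [h] at this
    rw [he]
    refine and_congr_right fun hlt => ?_
    rw [← forall_mul_lt_iff hβ ht]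
    refine forall₂_congr fun s hs => ?_
    rw [position_of_le hξ hs.1 (hs.2.trans hlt.le), hV]
  | succ m ih =>
    rw [TurnsBelow]
    by_cases hle : ξ 0 ω ≤ t
    · rw [encard_events_shift ξ ω hle]
      simp only [hle, true_and]
      have key : (({n | eventTime (fun i => ξ (i + 1)) n ω ≤ t - ξ 0 ω}.encard = m) ∧
          ∀ s ∈ Set.Icc 0 t, position c₁ c₂ V₀ ξ s ω < β) ↔
          v * ξ 0 ω < β ∧ ({n | eventTime (fun i => ξ (i + 1)) n ω ≤ t - ξ 0 ω}.encard = m ∧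
            ∀ s ∈ Set.Icc 0 (t - ξ 0 ω),
              position c₁ c₂ (fun _ => w) (fun i => ξ (i + 1)) s ω < β - v * ξ 0 ω) := by
        rw [and_left_comm]
        refine and_congr_right fun hm => ?_
        have hfin : {n | eventTime ξ n ω ≤ t}.Finite := by
          rw [← Set.encard_lt_top_iff, encard_events_shift ξ ω hle, hm]
          exact ENat.natCast_lt_top (m + 1)
        constructor
        · refine fun H => ⟨?_, fun s hs => ?_⟩
          · simpa [position_of_le hξ (hξ 0) le_rfl, hV] using H (ξ 0 ω) ⟨hξ 0, hle⟩
          · have h1 : ξ 0 ω ≤ s + ξ 0 ω := by linarith [hs.1]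
            have h2 : s + ξ 0 ω ≤ t := by linarith [hs.2]
            have := H (s + ξ 0 ω) ⟨(hξ 0).trans h1, h2⟩
            rw [position_shift hc₁ hc₂ h hV hξ h1
              (hfin.subset fun n hn => le_trans hn h2), add_sub_cancel_right] at this
            linarith
        · rintro ⟨H1, H2⟩ s hs
          rcases le_total s (ξ 0 ω) with hs' | hs'
          · rw [position_of_le hξ hs.1 hs', hV]
            exact (forall_mul_lt_iff hβ (hξ 0)).2 H1 s ⟨hs.1, hs'⟩
          · rw [position_shift hc₁ hc₂ h hV hξ hs' (hfin.subset fun n hn => le_trans hn hs.2)]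
            have := H2 (s - ξ 0 ω) ⟨by linarith, by linarith [hs.2]⟩
            linarith
      have hcast : ∀ e : ℕ∞, e + 1 = ((m + 1 : ℕ) : ℕ∞) ↔ e = m := fun e => by
        rw [Nat.cast_add, Nat.cast_one]
        exact (ENat.add_left_injective_of_ne_top ENat.one_ne_top).eq_iff
      rw [hcast, key]
      refine and_congr_right fun hlt => ?_
      exact ih h.symm rfl (fun n => hξ (n + 1)) (by linarith) (by linarith)
    · rw [events_eq_empty hξ (not_le.1 hle)]
      have : ¬ ((0 : ℕ∞) = ((m + 1 : ℕ) : ℕ∞)) := by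
        exact_mod_cast (Nat.succ_ne_zero m).symm
      simp [hle]
      intro h0
      exact absurd h0 (by exact_mod_cast this)

/-- A nonzero value of `count` is the genuine number of events. -/
theorem encard_events_eq_iff (ξ : ℕ → Ω → ℝ) (ω : Ω) (t : ℝ) {m : ℕ} (hm : m ≠ 0) :
    {n | eventTime ξ n ω ≤ t}.encard = m ↔ count ξ t ω = m :=
  ⟨fun h => by rw [count, Set.ncard, h, ENat.toNat_natCast], fun h => by
    have hfin : {n | eventTime ξ n ω ≤ t}.Finite := Set.finite_of_ncard_ne_zero (by
      rw [count] at h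
      rwa [h])
    rw [← hfin.cast_ncard_eq]
    exact_mod_cast h⟩

theorem position_le {c₁ c₂ : ℝ} (hc₁ : 0 < c₁) (hc₂ : 0 < c₂) {V₀ : Ω → ℝ} {ω : Ω}
    (hV : V₀ ω = c₁) (ξ : ℕ → Ω → ℝ) {s : ℝ} (hs : 0 ≤ s) :
    position c₁ c₂ V₀ ξ s ω ≤ c₁ * s := by
  have h : position c₁ c₂ V₀ ξ s ω ≤ ∫ _ in (0 : ℝ)..s, c₁ := by
    refine intervalIntegral.integral_mono_on hs (intervalIntegrable_velocity _ _ _ _ _ _ _)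
      intervalIntegrable_const fun u _ => ?_
    rw [velocity_eq hc₁ hc₂ (Or.inl ⟨rfl, rfl⟩) hV]
    split_ifs <;> linarith
  rw [intervalIntegral.integral_const, sub_zero, smul_eq_mul] at h
  linarith

theorem maxPosition_lt_iff (c₁ c₂ : ℝ) (V₀ : Ω → ℝ) (ξ : ℕ → Ω → ℝ) {t : ℝ} (ht : 0 ≤ t) (ω : Ω)
    (β : ℝ) :
    maxPosition c₁ c₂ V₀ ξ t ω < β ↔ ∀ s ∈ Set.Icc 0 t, position c₁ c₂ V₀ ξ s ω < β := by
  have h := isGreatest_maxPosition c₁ c₂ V₀ ξ ht ω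
  refine ⟨fun H s hs => (h.2 ⟨s, hs, rfl⟩).trans_lt H, fun H => ?_⟩
  obtain ⟨s, hs, e⟩ := h.1
  rw [← e]
  exact H s hs

/-! ### Probability: conditioning on the first waiting time. -/

theorem measurableSet_turnsBelow (v w : ℝ) (m : ℕ) :
    MeasurableSet {p : ℝ × ℝ × (ℕ → ℝ) | TurnsBelow v w m p.1 p.2.1 p.2.2} := by
  have hx : Measurable fun p : ℝ × ℝ × (ℕ → ℝ) => p.2.2 0 := by fun_prop
  have hβ : Measurable fun p : ℝ × ℝ × (ℕ → ℝ) => p.2.1 := by fun_prop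
  cases m with
  | zero =>
    exact (measurableSet_lt measurable_fst hx).inter
      (measurableSet_lt (measurable_fst.const_mul v) hβ)
  | succ m =>
    have hg : Measurable fun p : ℝ × ℝ × (ℕ → ℝ) =>
        (p.1 - p.2.2 0, p.2.1 - v * p.2.2 0, fun n => p.2.2 (n + 1)) := by fun_prop
    exact (measurableSet_le hx measurable_fst).inter
      ((measurableSet_lt (hx.const_mul v) hβ).inter (hg (measurableSet_turnsBelow w v m)))

/-- A sequence of independent exponentially distributed waiting times with rate `lam`. -/
structure IsPoissonWaiting [MeasurableSpace Ω] (lam : ℝ) (P : Measure Ω) (ξ : ℕ → Ω → ℝ) :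
    Prop where
  measurable : ∀ n, Measurable (ξ n)
  law : ∀ n, P.map (ξ n) = expMeasure lam
  indep : iIndepFun ξ P

section

variable [MeasurableSpace Ω] {lam : ℝ} {P : Measure Ω} {ξ : ℕ → Ω → ℝ}

theorem IsPoissonWaiting.shift (h : IsPoissonWaiting lam P ξ) :
    IsPoissonWaiting lam P (fun n => ξ (n + 1)) where
  measurable n := h.measurable (n + 1)
  law n := h.law (n + 1)
  indep := h.indep.precomp (add_left_injective 1)

theorem IsPoissonWaiting.measurable_pi (h : IsPoissonWaiting lam P ξ) :
    Measurable fun ω n => ξ n ω :=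
  measurable_pi_lambda _ h.measurable

theorem IsPoissonWaiting.indepFun_shift [IsProbabilityMeasure P] (h : IsPoissonWaiting lam P ξ) :
    IndepFun (ξ 0) (fun ω n => ξ (n + 1) ω) P := by
  refine IndepFun.indepFun_process (h.measurable 0) (fun n => h.measurable (n + 1)) fun I => ?_
  have hd : Disjoint ({0} : Finset ℕ) (I.map ⟨Nat.succ, Nat.succ_injective⟩) := by simp
  have e := h.indep.indepFun_finset _ _ hd h.measurable
  have hφ : Measurable fun f : ({0} : Finset ℕ) → ℝ => f ⟨0, by simp⟩ := measurable_pi_apply _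
  have hψ : Measurable fun (f : I.map ⟨Nat.succ, Nat.succ_injective⟩ → ℝ) (i : I) =>
      f ⟨i + 1, Finset.mem_map_of_mem _ i.2⟩ :=
    measurable_pi_lambda _ fun i => measurable_pi_apply _
  exact e.comp hφ hψ

theorem lintegral_expMeasure (f : ℝ → ENNReal) (hf : Measurable f) :
    ∫⁻ s, f s ∂expMeasure lam =
      ∫⁻ s in Set.Ici 0, ENNReal.ofReal (lam * Real.exp (-(lam * s))) * f s := by
  have h : expMeasure lam = volume.withDensity (exponentialPDF lam) := rfl
  have hm : Measurable (exponentialPDF lam) := (measurable_exponentialPDFReal lam).ennreal_ofReal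
  rw [h, lintegral_withDensity_eq_lintegral_mul _ hm hf, ← lintegral_indicator measurableSet_Ici]
  refine lintegral_congr fun s => ?_
  by_cases hs : 0 ≤ s
  · simp [hs, exponentialPDF_of_nonneg hs]
  · simp [hs, exponentialPDF_of_neg (not_le.1 hs)]

/-- The first waiting time is independent of the shifted sequence, so the joint law is a product and
Tonelli applies. -/
theorem IsPoissonWaiting.measure_turnsBelow_succ [IsProbabilityMeasure P]
    (h : IsPoissonWaiting lam P ξ) (v w : ℝ) (m : ℕ) (t β : ℝ) :
    P {ω | TurnsBelow v w (m + 1) t β (fun n => ξ n ω)} =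
      ∫⁻ s in Set.Ici 0, ENNReal.ofReal (lam * Real.exp (-(lam * s))) *
        P {ω | s ≤ t ∧ v * s < β ∧ TurnsBelow w v m (t - s) (β - v * s) (fun n => ξ (n + 1) ω)} := by
  set A : Set (ℝ × (ℕ → ℝ)) := {p | p.1 ≤ t ∧ v * p.1 < β ∧
    TurnsBelow w v m (t - p.1) (β - v * p.1) p.2} with hA
  have hAm : MeasurableSet A := by
    have hg : Measurable fun p : ℝ × (ℕ → ℝ) => (t - p.1, β - v * p.1, p.2) := by fun_prop
    exact (measurableSet_le measurable_fst measurable_const).inter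
      ((measurableSet_lt (measurable_fst.const_mul v) measurable_const).inter
        (hg (measurableSet_turnsBelow w v m)))
  have hpair : Measurable fun ω => (ξ 0 ω, fun n => ξ (n + 1) ω) :=
    (h.measurable 0).prodMk h.shift.measurable_pi
  have e : P {ω | TurnsBelow v w (m + 1) t β (fun n => ξ n ω)} =
      P.map (fun ω => (ξ 0 ω, fun n => ξ (n + 1) ω)) A := by
    rw [Measure.map_apply hpair hAm]
    rfl
  have hsf : IsProbabilityMeasure (P.map fun ω n => ξ (n + 1) ω) :=
    Measure.isProbabilityMeasure_map h.shift.measurable_pi.aemeasurable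
  rw [e, (indepFun_iff_map_prod_eq_prod_map_map (h.measurable 0).aemeasurable
    h.shift.measurable_pi.aemeasurable).1 h.indepFun_shift, Measure.prod_apply hAm, h.law,
    lintegral_expMeasure _ (measurable_measure_prodMk_left hAm)]
  refine lintegral_congr fun s => ?_
  rw [Measure.map_apply h.shift.measurable_pi (measurable_prodMk_left hAm)]
  rfl

/-- Conditioning on the first waiting time, which has to be at most `S`. -/
theorem IsPoissonWaiting.real_turnsBelow_succ [IsProbabilityMeasure P]
    (h : IsPoissonWaiting lam P ξ) (hlam : 0 < lam) {v w : ℝ} {m : ℕ} {t β S κ : ℝ} (hS : 0 ≤ S)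
    {g : ℝ → ℝ} (hg : Continuous g)
    (hlt : ∀ s ∈ Set.Ioo 0 S, s ≤ t ∧ v * s < β ∧
      P.real {ω | TurnsBelow w v m (t - s) (β - v * s) (fun n => ξ (n + 1) ω)} =
        κ * Real.exp (-(lam * (t - s))) * g s)
    (hgt : ∀ s, S < s → s ≤ t → β ≤ v * s) :
    P.real {ω | TurnsBelow v w (m + 1) t β (fun n => ξ n ω)} =
      lam * κ * Real.exp (-(lam * t)) * ∫ s in (0 : ℝ)..S, g s := by
  have hexp : ∀ s, lam * κ * Real.exp (-(lam * t)) * g s =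
      lam * Real.exp (-(lam * s)) * (κ * Real.exp (-(lam * (t - s))) * g s) := fun s => by
    have : Real.exp (-(lam * t)) = Real.exp (-(lam * s)) * Real.exp (-(lam * (t - s))) := by
      rw [← Real.exp_add]
      ring_nf
    rw [this]
    ring
  -- No sign is assumed for `κ` or `g`: the integrand is a density times a probability.
  have hnn : ∀ s ∈ Set.Ioo 0 S, 0 ≤ lam * κ * Real.exp (-(lam * t)) * g s := fun s hs => by
    rw [hexp, ← (hlt s hs).2.2]
    positivity
  have key : P {ω | TurnsBelow v w (m + 1) t β (fun n => ξ n ω)} =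
      ∫⁻ s in Set.Ioo 0 S, ENNReal.ofReal (lam * κ * Real.exp (-(lam * t)) * g s) := by
    rw [h.measure_turnsBelow_succ, ← lintegral_indicator measurableSet_Ici,
      ← lintegral_indicator measurableSet_Ioo]
    refine lintegral_congr_ae ?_
    filter_upwards [Measure.ae_ne volume (0 : ℝ), Measure.ae_ne volume S] with s hs0 hsS
    by_cases hs : s ∈ Set.Ioo 0 S
    · obtain ⟨h1, h2, h3⟩ := hlt s hs
      rw [Set.indicator_of_mem (Set.mem_Ici.2 hs.1.le), Set.indicator_of_mem hs, hexp, ← h3,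
        ENNReal.ofReal_mul (mul_nonneg hlam.le (Real.exp_nonneg _)), ofReal_measureReal]
      simp [h1, h2]
    · rw [Set.indicator_of_notMem hs]
      by_cases h0 : 0 ≤ s
      · rw [Set.indicator_of_mem (Set.mem_Ici.2 h0)]
        have hSs : S < s := lt_of_le_of_ne
          (not_lt.1 fun hc => hs ⟨lt_of_le_of_ne h0 (Ne.symm hs0), hc⟩) (Ne.symm hsS)
        have : {ω | s ≤ t ∧ v * s < β ∧
            TurnsBelow w v m (t - s) (β - v * s) (fun n => ξ (n + 1) ω)} = ∅ := by
          ext ω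
          simp only [Set.mem_ofPred_eq, Set.mem_empty_iff_false, iff_false]
          exact fun hc => absurd hc.2.1 (not_lt.2 (hgt s hSs hc.1))
        rw [this, measure_empty, mul_zero]
      · rw [Set.indicator_of_notMem (by simpa using h0)]
  rw [Measure.real, key, ← intervalIntegral.integral_const_mul,
    intervalIntegral.integral_of_le hS, integral_Ioc_eq_integral_Ioo,
    integral_eq_lintegral_of_nonneg_ae
      ((ae_restrict_iff' measurableSet_Ioo).2 (Filter.Eventually.of_forall hnn))
      (by fun_prop)]

theorem IsPoissonWaiting.real_turnsBelow_zero (h : IsPoissonWaiting lam P ξ) (hlam : 0 < lam)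
    {v w t β : ℝ} (ht : 0 ≤ t) (hβ : v * t < β) :
    P.real {ω | TurnsBelow v w 0 t β (fun n => ξ n ω)} = Real.exp (-(lam * t)) := by
  have e : {ω | TurnsBelow v w 0 t β (fun n => ξ n ω)} = ξ 0 ⁻¹' (Set.Iic t)ᶜ := by
    ext ω
    simp [TurnsBelow, hβ]
  have : IsProbabilityMeasure (expMeasure lam) := isProbabilityMeasure_expMeasure hlam
  rw [e, ← map_measureReal_apply (h.measurable 0) measurableSet_Iic.compl, h.law,
    probReal_compl_eq_one_sub measurableSet_Iic, ← cdf_eq_real, cdf_expMeasure_eq hlam, if_pos ht]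
  ring

theorem IsPoissonWaiting.ae_nonneg (h : IsPoissonWaiting lam P ξ) :
    ∀ᵐ ω ∂P, ∀ n, 0 ≤ ξ n ω := by
  rw [ae_all_iff]
  intro n
  have e : ∀ᵐ x ∂expMeasure lam, 0 ≤ x := by
    rw [ae_iff]
    have : {x : ℝ | ¬ 0 ≤ x} = Set.Iio 0 := by
      ext x
      simp
    rw [this, expMeasure, gammaMeasure, withDensity_apply _ measurableSet_Iio]
    exact lintegral_exponentialPDF_of_nonpos le_rfl
  rw [← h.law n] at e
  exact ae_of_ae_map (h.measurable n).aemeasurable e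

end

/-! ### Polynomial volumes and their antiderivatives. -/

/-- The divided power `zⁱ / i!`. -/
def dividedPow (i : ℕ) (z : ℝ) : ℝ :=
  z ^ i / i.factorial

theorem dividedPow_zero (z : ℝ) : dividedPow 0 z = 1 := by simp [dividedPow]

theorem dividedPow_apply_zero {i : ℕ} (hi : i ≠ 0) : dividedPow i 0 = 0 := by
  simp [dividedPow, hi]

theorem hasDerivAt_dividedPow_succ (i : ℕ) (z : ℝ) :
    HasDerivAt (dividedPow (i + 1)) (dividedPow i z) z := by
  refine ((hasDerivAt_pow (i + 1) z).div_const ((i + 1).factorial : ℝ)).congr_deriv ?_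
  rw [dividedPow, Nat.factorial_succ, add_tsub_cancel_right]
  push_cast
  field_simp

@[fun_prop]
theorem continuous_dividedPow (i : ℕ) : Continuous (dividedPow i) := by
  unfold dividedPow
  fun_prop

/-- Up to a factor, the probability of `2k+1` turns with maximum below `β`, when the first
velocity is `c₁`, in the coordinates `x = c₁t - β ≥ 0`, `y = c₂t + β`, with `ρ = c₂/c₁`. -/
def oddPoly (ρ : ℝ) (k : ℕ) (x y : ℝ) : ℝ :=
  ∑ j ∈ Finset.range (k + 1), (dividedPow j x * dividedPow (2 * k + 1 - j) y -
    ρ ^ (2 * k + 1 - 2 * j) * dividedPow (2 * k + 1 - j) x * dividedPow j y)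

/-- Up to a factor, the probability of `2k` turns with maximum below `β`, when the first
velocity is `-c₂`, in the coordinates `x = c₁t - β ≥ 0`, `y = c₂t + β`, with `ρ = c₂/c₁`. -/
def evenPoly (ρ : ℝ) (k : ℕ) (x y : ℝ) : ℝ :=
  ∑ j ∈ Finset.range (k + 1), dividedPow j x * dividedPow (2 * k - j) y -
    ∑ j ∈ Finset.range k, ρ ^ (2 * k - 1 - 2 * j) * dividedPow (2 * k - j) x * dividedPow j y

/-- Every divided power of `y` drops by one index. The subtracted term `j = 0` is constant in `y`,
which is why the second sum of `evenPoly` has one term fewer. -/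
theorem hasDerivAt_oddPoly (ρ : ℝ) (k : ℕ) (x y : ℝ) :
    HasDerivAt (oddPoly ρ k x) (evenPoly ρ k x y) y := by
  have h1 : HasDerivAt (fun y => ∑ j ∈ Finset.range (k + 1),
      dividedPow j x * dividedPow (2 * k + 1 - j) y)
      (∑ j ∈ Finset.range (k + 1), dividedPow j x * dividedPow (2 * k - j) y) y := by
    refine HasDerivAt.fun_sum fun j hj => ?_
    have e : 2 * k + 1 - j = 2 * k - j + 1 := by
      have := Finset.mem_range.1 hj
      omega
    rw [e]
    exact (hasDerivAt_dividedPow_succ _ y).const_mul _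
  have h2 : HasDerivAt (fun y => ∑ j ∈ Finset.range (k + 1),
      ρ ^ (2 * k + 1 - 2 * j) * dividedPow (2 * k + 1 - j) x * dividedPow j y)
      (∑ j ∈ Finset.range k, ρ ^ (2 * k - 1 - 2 * j) * dividedPow (2 * k - j) x *
        dividedPow j y) y := by
    simp only [Finset.sum_range_succ' _ k, dividedPow_zero]
    refine HasDerivAt.add_const _ (HasDerivAt.fun_sum fun j hj => ?_)
    have e1 : 2 * k + 1 - (j + 1) = 2 * k - j := by omega
    have e2 : 2 * k + 1 - 2 * (j + 1) = 2 * k - 1 - 2 * j := by omega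
    rw [e1, e2]
    exact (hasDerivAt_dividedPow_succ _ y).const_mul _
  have e : oddPoly ρ k x = fun y => ∑ j ∈ Finset.range (k + 1),
      dividedPow j x * dividedPow (2 * k + 1 - j) y - ∑ j ∈ Finset.range (k + 1),
        ρ ^ (2 * k + 1 - 2 * j) * dividedPow (2 * k + 1 - j) x * dividedPow j y :=
    funext fun y => by rw [oddPoly, Finset.sum_sub_distrib]
  rw [e]
  exact h1.fun_sub h2

theorem hasDerivAt_evenPoly_succ (ρ : ℝ) (k : ℕ) (x y : ℝ) :
    HasDerivAt (fun x => evenPoly ρ (k + 1) x y) (oddPoly ρ k x y) x := by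
  have h1 : HasDerivAt (fun x => ∑ j ∈ Finset.range (k + 1 + 1),
      dividedPow j x * dividedPow (2 * (k + 1) - j) y)
      (∑ j ∈ Finset.range (k + 1), dividedPow j x * dividedPow (2 * k + 1 - j) y) x := by
    simp only [Finset.sum_range_succ' _ (k + 1), dividedPow_zero]
    refine HasDerivAt.add_const _ (HasDerivAt.fun_sum fun j hj => ?_)
    have e : 2 * (k + 1) - (j + 1) = 2 * k + 1 - j := by omega
    rw [e]
    exact (hasDerivAt_dividedPow_succ _ x).mul_const _
  have h2 : HasDerivAt (fun x => ∑ j ∈ Finset.range (k + 1),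
      ρ ^ (2 * (k + 1) - 1 - 2 * j) * dividedPow (2 * (k + 1) - j) x * dividedPow j y)
      (∑ j ∈ Finset.range (k + 1),
        ρ ^ (2 * k + 1 - 2 * j) * dividedPow (2 * k + 1 - j) x * dividedPow j y) x := by
    refine HasDerivAt.fun_sum fun j hj => ?_
    have hj' := Finset.mem_range.1 hj
    have e1 : 2 * (k + 1) - j = 2 * k + 1 - j + 1 := by omega
    have e2 : 2 * (k + 1) - 1 - 2 * j = 2 * k + 1 - 2 * j := by omega
    rw [e1, e2]
    exact ((hasDerivAt_dividedPow_succ _ x).const_mul _).mul_const _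
  exact (h1.fun_sub h2).congr_deriv (by rw [oddPoly, Finset.sum_sub_distrib])

/-- The line `y = ρx` is fixed by the reflection, so the summands vanish one by one. It is the state
in which the level has just been reached, `β = 0`. -/
theorem oddPoly_mul_self (ρ : ℝ) (k : ℕ) (x : ℝ) : oddPoly ρ k x (ρ * x) = 0 := by
  refine Finset.sum_eq_zero fun j hj => ?_
  obtain ⟨i, hi⟩ : ∃ i, 2 * k + 1 = 2 * j + i :=
    Nat.exists_eq_add_of_le (by have := Finset.mem_range.1 hj; omega)
  have e1 : 2 * k + 1 - j = j + i := by omega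
  have e2 : 2 * k + 1 - 2 * j = i := by omega
  rw [e1, e2]
  simp only [dividedPow]
  ring

theorem oddPoly_zero_left (ρ : ℝ) (k : ℕ) (y : ℝ) :
    oddPoly ρ k 0 y = dividedPow (2 * k + 1) y := by
  rw [oddPoly, Finset.sum_eq_single 0]
  · rw [dividedPow_zero, dividedPow_apply_zero (by omega)]
    simp
  · intro j hj hj0
    have := Finset.mem_range.1 hj
    rw [dividedPow_apply_zero hj0, dividedPow_apply_zero (by omega)]
    simp
  · simp

theorem evenPoly_zero_left (ρ : ℝ) (k : ℕ) (y : ℝ) :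
    evenPoly ρ k 0 y = dividedPow (2 * k) y := by
  rw [evenPoly, Finset.sum_eq_single 0, Finset.sum_eq_zero]
  · simp [dividedPow_zero]
  · intro j hj
    have := Finset.mem_range.1 hj
    rw [dividedPow_apply_zero (i := 2 * k - j) (by omega)]
    simp
  · intro j hj hj0
    rw [dividedPow_apply_zero hj0, zero_mul]
  · simp

/-- The extension of `oddPoly` to `x ≤ 0`, where the level `β` cannot be reached. -/
def oddVolume (ρ : ℝ) (k : ℕ) (x y : ℝ) : ℝ :=
  if x ≤ 0 then dividedPow (2 * k + 1) (x + y) else oddPoly ρ k x y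

/-- The extension of `evenPoly` to `x ≤ 0`, where the level `β` cannot be reached. -/
def evenVolume (ρ : ℝ) (k : ℕ) (x y : ℝ) : ℝ :=
  if x ≤ 0 then dividedPow (2 * k) (x + y) else evenPoly ρ k x y

theorem continuous_oddVolume_left (ρ : ℝ) (k : ℕ) (y : ℝ) :
    Continuous fun x => oddVolume ρ k x y := by
  refine Continuous.if_le (by fun_prop) ?_ continuous_id continuous_const ?_
  · unfold oddPoly
    fun_prop
  · rintro x rfl
    rw [oddPoly_zero_left, zero_add]

theorem continuous_evenVolume_left (ρ : ℝ) (k : ℕ) (y : ℝ) :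
    Continuous fun x => evenVolume ρ k x y := by
  refine Continuous.if_le (by fun_prop) ?_ continuous_id continuous_const ?_
  · unfold evenPoly
    fun_prop
  · rintro x rfl
    rw [evenPoly_zero_left, zero_add]

theorem continuous_evenVolume_right (ρ : ℝ) (k : ℕ) (x : ℝ) :
    Continuous fun y => evenVolume ρ k x y := by
  unfold evenVolume evenPoly
  split_ifs <;> fun_prop

theorem hasDerivAt_oddVolume (ρ : ℝ) (k : ℕ) (x y : ℝ) :
    HasDerivAt (oddVolume ρ k x) (evenVolume ρ k x y) y := by
  unfold oddVolume evenVolume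
  split_ifs
  · exact (hasDerivAt_dividedPow_succ (2 * k) (x + y)).comp_const_add x y
  · exact hasDerivAt_oddPoly ρ k x y

theorem hasDerivAt_evenVolume_succ (ρ : ℝ) (k : ℕ) {x : ℝ} (hx : x ≠ 0) (y : ℝ) :
    HasDerivAt (fun x => evenVolume ρ (k + 1) x y) (oddVolume ρ k x y) x := by
  rcases lt_or_gt_of_ne hx with hx | hx
  · rw [oddVolume, if_pos hx.le]
    refine ((hasDerivAt_dividedPow_succ (2 * k + 1)
      (x + y)).comp_add_const x y).congr_of_eventuallyEq
      ?_
    filter_upwards [Iio_mem_nhds hx] with z hz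
    exact if_pos (le_of_lt hz)
  · rw [oddVolume, if_neg (not_le.2 hx)]
    refine (hasDerivAt_evenPoly_succ ρ k x y).congr_of_eventuallyEq ?_
    filter_upwards [Ioi_mem_nhds hx] with z hz
    exact if_neg (not_le.2 hz)

theorem integral_evenVolume (ρ : ℝ) (k : ℕ) (x y : ℝ) {C : ℝ} (hC : C ≠ 0) (S : ℝ) :
    ∫ s in (0 : ℝ)..S, evenVolume ρ k x (y - C * s) =
      (oddVolume ρ k x y - oddVolume ρ k x (y - C * S)) / C := by
  have h := intervalIntegral.integral_comp_sub_mul (a := 0) (b := S)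
    (fun z => evenVolume ρ k x z) hC y
  rw [h, intervalIntegral.integral_eq_sub_of_hasDerivAt
    (fun z _ => hasDerivAt_oddVolume ρ k x z)
    ((continuous_evenVolume_right ρ k x).intervalIntegrable _ _), mul_zero, sub_zero, smul_eq_mul]
  field_simp

theorem integral_oddVolume (ρ : ℝ) (k : ℕ) (x y : ℝ) {C : ℝ} (hC : C ≠ 0) (S : ℝ) :
    ∫ s in (0 : ℝ)..S, oddVolume ρ k (x - C * s) y =
      (evenVolume ρ (k + 1) x y - evenVolume ρ (k + 1) (x - C * S) y) / C := by
  have h := intervalIntegral.integral_comp_sub_mul (a := 0) (b := S)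
    (fun z => oddVolume ρ k z y) hC x
  -- The range of `x` may cross the seam `x = 0` of the piecewise definition; continuity there
  -- suffices.
  rw [h, integral_eq_of_hasDerivAt_off_countable (fun z => evenVolume ρ (k + 1) z y) _
    (Set.countable_singleton (0 : ℝ)) (continuous_evenVolume_left ρ (k + 1) y).continuousOn
    (fun z hz => hasDerivAt_evenVolume_succ ρ k hz.2 y)
    ((continuous_oddVolume_left ρ k y).intervalIntegrable _ _), mul_zero, sub_zero, smul_eq_mul]
  field_simp

/-! ### Induction on the number of turns. -/

section

variable [MeasurableSpace Ω] {lam : ℝ} {P : Measure Ω} [IsProbabilityMeasure P] {ξ : ℕ → Ω → ℝ}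
  {c₁ c₂ : ℝ}

/-- The probability for an odd number of turns, obtained from the one for the even number of turns
that remain after the first. -/
theorem real_turnsBelow_odd_of_even (hc₁ : 0 < c₁) (hc₂ : 0 < c₂) (hlam : 0 < lam) {k : ℕ}
    (h : IsPoissonWaiting lam P ξ)
    (heven : ∀ t β : ℝ, 0 ≤ t → 0 < β →
      P.real {ω | TurnsBelow (-c₂) c₁ (2 * k) t β (fun n => ξ (n + 1) ω)} =
        (lam / (c₁ + c₂)) ^ (2 * k) * Real.exp (-(lam * t)) *
          evenVolume (c₂ / c₁) k (c₁ * t - β) (c₂ * t + β))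
    {t β : ℝ} (ht : 0 ≤ t) (hβ : 0 ≤ β) :
    P.real {ω | TurnsBelow c₁ (-c₂) (2 * k + 1) t β (fun n => ξ n ω)} =
      (lam / (c₁ + c₂)) ^ (2 * k + 1) * Real.exp (-(lam * t)) *
        oddVolume (c₂ / c₁) k (c₁ * t - β) (c₂ * t + β) := by
  have hC : c₁ + c₂ ≠ 0 := by positivity
  have hcont : Continuous fun s =>
      evenVolume (c₂ / c₁) k (c₁ * t - β) (c₂ * t + β - (c₁ + c₂) * s) :=
    (continuous_evenVolume_right (c₂ / c₁) k (c₁ * t - β)).comp (by fun_prop)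
  have hstep : ∀ s, s ≤ t → c₁ * s < β →
      P.real {ω | TurnsBelow (-c₂) c₁ (2 * k) (t - s) (β - c₁ * s) (fun n => ξ (n + 1) ω)} =
        (lam / (c₁ + c₂)) ^ (2 * k) * Real.exp (-(lam * (t - s))) *
          evenVolume (c₂ / c₁) k (c₁ * t - β) (c₂ * t + β - (c₁ + c₂) * s) := fun s h1 h2 => by
    rw [heven _ _ (by linarith) (by linarith)]
    congr 2 <;> ring
  -- `S` is the longest admissible first stretch: `t` if the level is out of reach, else the hitting
  -- time `β / c₁`. The boundary term vanishes because `x + y = 0` in the first case and `y = ρx` in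
  -- the second.
  obtain ⟨S, hS, hlt, hgt, hval⟩ : ∃ S, 0 ≤ S ∧ (∀ s ∈ Set.Ioo 0 S, s ≤ t ∧ c₁ * s < β) ∧
      (∀ s, S < s → s ≤ t → β ≤ c₁ * s) ∧
      oddVolume (c₂ / c₁) k (c₁ * t - β) (c₂ * t + β - (c₁ + c₂) * S) = 0 := by
    by_cases hx : c₁ * t - β ≤ 0
    · refine ⟨t, ht, fun s hs => ⟨hs.2.le, ?_⟩, fun s h1 h2 => absurd h1 (not_lt.2 h2), ?_⟩
      · have := mul_lt_mul_of_pos_left hs.2 hc₁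
        linarith
      · rw [oddVolume, if_pos hx, ← dividedPow_apply_zero (Nat.succ_ne_zero (2 * k))]
        congr 1
        ring
    · have hx' : β < c₁ * t := by linarith [not_le.1 hx]
      refine ⟨β / c₁, by positivity, fun s hs => ?_, fun s h1 _ => ?_, ?_⟩
      · have h1 : s * c₁ < β := (lt_div_iff₀ hc₁).1 hs.2
        refine ⟨?_, by linarith⟩
        by_contra hts
        have := mul_lt_mul_of_pos_left (not_le.1 hts) hc₁
        linarith
      · have := (div_lt_iff₀ hc₁).1 h1
        linarith
      · rw [oddVolume, if_neg hx, ← oddPoly_mul_self (c₂ / c₁) k (c₁ * t - β)]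
        congr 1
        field_simp
        ring
  rw [h.real_turnsBelow_succ hlam hS hcont
    (fun s hs => ⟨(hlt s hs).1, (hlt s hs).2, hstep s (hlt s hs).1 (hlt s hs).2⟩) hgt,
    integral_evenVolume _ _ _ _ hC, hval, pow_succ]
  ring

/-- One induction step removes two turns, so the hypothesis is used for the twice shifted sequence.
A first stretch at `-c₂` moves away from the level and is bounded only by `t`, where `x + y = 0`. -/
theorem real_turnsBelow_even (hc₁ : 0 < c₁) (hc₂ : 0 < c₂) (hlam : 0 < lam) (k : ℕ)
    (h : IsPoissonWaiting lam P ξ) {t β : ℝ} (ht : 0 ≤ t) (hβ : 0 < β) :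
    P.real {ω | TurnsBelow (-c₂) c₁ (2 * k) t β (fun n => ξ n ω)} =
      (lam / (c₁ + c₂)) ^ (2 * k) * Real.exp (-(lam * t)) *
        evenVolume (c₂ / c₁) k (c₁ * t - β) (c₂ * t + β) := by
  induction k generalizing ξ t β with
  | zero =>
    have hlt : -c₂ * t < β := by
      have := mul_nonneg hc₂.le ht
      linarith
    rw [mul_zero, h.real_turnsBelow_zero hlam ht hlt]
    simp [evenVolume, evenPoly, dividedPow_zero]
  | succ k ih =>
    have hC : c₁ + c₂ ≠ 0 := by positivity
    have hcont : Continuous fun s =>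
        oddVolume (c₂ / c₁) k (c₁ * t - β - (c₁ + c₂) * s) (c₂ * t + β) :=
      (continuous_oddVolume_left (c₂ / c₁) k (c₂ * t + β)).comp (by fun_prop)
    have hlt : ∀ s ∈ Set.Ioo 0 t, s ≤ t ∧ -c₂ * s < β ∧
        P.real {ω | TurnsBelow c₁ (-c₂) (2 * k + 1) (t - s) (β - -c₂ * s)
            (fun n => ξ (n + 1) ω)} =
          (lam / (c₁ + c₂)) ^ (2 * k + 1) * Real.exp (-(lam * (t - s))) *
            oddVolume (c₂ / c₁) k (c₁ * t - β - (c₁ + c₂) * s) (c₂ * t + β) := fun s hs => by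
      have h0 := mul_nonneg hc₂.le hs.1.le
      refine ⟨hs.2.le, by linarith, ?_⟩
      rw [real_turnsBelow_odd_of_even hc₁ hc₂ hlam h.shift
        (fun t β ht hβ => ih h.shift.shift ht hβ) (by linarith [hs.2]) (by linarith)]
      congr 2 <;> ring
    have hy : 0 ≤ c₂ * t := by positivity
    have hval : evenVolume (c₂ / c₁) (k + 1) (c₁ * t - β - (c₁ + c₂) * t) (c₂ * t + β) = 0 := by
      rw [evenVolume, if_pos (by linarith),
        ← dividedPow_apply_zero (by omega : 2 * (k + 1) ≠ 0)]
      congr 1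
      ring
    rw [show 2 * (k + 1) = 2 * k + 1 + 1 by ring, h.real_turnsBelow_succ hlam ht hcont hlt
      (fun s h1 h2 => absurd h1 (not_lt.2 h2)), integral_oddVolume _ _ _ _ hC, hval, pow_succ]
    ring

theorem real_turnsBelow_odd (hc₁ : 0 < c₁) (hc₂ : 0 < c₂) (hlam : 0 < lam) (k : ℕ)
    (h : IsPoissonWaiting lam P ξ) {t β : ℝ} (ht : 0 ≤ t) (hβ : 0 ≤ β) :
    P.real {ω | TurnsBelow c₁ (-c₂) (2 * k + 1) t β (fun n => ξ n ω)} =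
      (lam / (c₁ + c₂)) ^ (2 * k + 1) * Real.exp (-(lam * t)) *
        oddVolume (c₂ / c₁) k (c₁ * t - β) (c₂ * t + β) :=
  real_turnsBelow_odd_of_even hc₁ hc₂ hlam h
    (fun _ _ ht hβ => real_turnsBelow_even hc₁ hc₂ hlam k h.shift ht hβ) ht hβ

end

/-! ### Back to the telegraph process. -/

theorem oddVolume_of_nonneg (ρ : ℝ) (k : ℕ) {x : ℝ} (hx : 0 ≤ x) (y : ℝ) :
    oddVolume ρ k x y = oddPoly ρ k x y := by
  rcases hx.eq_or_lt with rfl | hx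
  · rw [oddVolume, if_pos le_rfl, oddPoly_zero_left, zero_add]
  · rw [oddVolume, if_neg (not_le.2 hx)]

theorem sum_choose_eq_oddPoly (ρ : ℝ) (k : ℕ) (x y D : ℝ) :
    ∑ j ∈ Finset.range (k + 1), ((2 * k + 1).choose j : ℝ) *
      ((x ^ j * y ^ (2 * k + 1 - j) - ρ ^ (2 * k + 1 - 2 * j) * x ^ (2 * k + 1 - j) * y ^ j) / D) =
      (2 * k + 1).factorial * oddPoly ρ k x y / D := by
  rw [oddPoly, Finset.mul_sum, Finset.sum_div]
  refine Finset.sum_congr rfl fun j hj => ?_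
  have := Finset.mem_range.1 hj
  rw [Nat.cast_choose ℝ (by omega : j ≤ 2 * k + 1)]
  simp only [dividedPow]
  field_simp

theorem measurable_count [MeasurableSpace Ω] {ξ : ℕ → Ω → ℝ} (hξ : ∀ n, Measurable (ξ n)) (t : ℝ) :
    Measurable (count ξ t) := by
  refine measurable_ncard.comp (measurable_set_iff.2 fun n => ?_)
  have hm : Measurable (eventTime ξ n) :=
    Finset.measurable_fun_sum (Finset.range (n + 1)) fun i _ => hξ i
  exact measurableSet_setOfPred.1 (measurableSet_le hm measurable_const)

variable [MeasurableSpace Ω] {c₁ c₂ lam : ℝ} {P : Measure Ω}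
  {V₀ : Ω → ℝ} {ξ : ℕ → Ω → ℝ}

theorem IsTelegraphInput.isPoissonWaiting (h : IsTelegraphInput c₁ c₂ lam P V₀ ξ) :
    IsPoissonWaiting lam P ξ :=
  ⟨h.measurable_waiting, h.law_waiting, h.indep_waiting⟩

theorem IsTelegraphInput.real_maxPosition_lt [IsProbabilityMeasure P]
    (h : IsTelegraphInput c₁ c₂ lam P V₀ ξ)
    (hc₁ : 0 < c₁) (hc₂ : 0 < c₂) (hlam : 0 < lam) (k : ℕ) {t β : ℝ} (ht : 0 ≤ t) (hβ : 0 < β) :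
    P.real ({ω | V₀ ω = c₁ ∧ count ξ t ω = 2 * k + 1} ∩ {ω | maxPosition c₁ c₂ V₀ ξ t ω < β}) =
      1 / 2 * ((lam / (c₁ + c₂)) ^ (2 * k + 1) * Real.exp (-(lam * t)) *
        oddVolume (c₂ / c₁) k (c₁ * t - β) (c₂ * t + β)) := by
  have hξ := h.isPoissonWaiting
  set B : Set (ℕ → ℝ) := {x | TurnsBelow c₁ (-c₂) (2 * k + 1) t β x}
  have hB : MeasurableSet B := by
    have hg : Measurable fun x : ℕ → ℝ => (t, β, x) := by fun_prop
    exact hg (measurableSet_turnsBelow c₁ (-c₂) (2 * k + 1))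
  have e : ({ω | V₀ ω = c₁ ∧ count ξ t ω = 2 * k + 1} ∩
      {ω | maxPosition c₁ c₂ V₀ ξ t ω < β} : Set Ω) =ᵐ[P]
      (V₀ ⁻¹' {c₁} ∩ (fun ω n => ξ n ω) ⁻¹' B : Set Ω) := by
    rw [Filter.eventuallyEq_set]
    filter_upwards [hξ.ae_nonneg] with ω hω
    simp only [Set.mem_inter_iff, Set.mem_ofPred_eq, Set.mem_preimage, Set.mem_singleton_iff,
      and_assoc, B]
    refine and_congr_right fun hV => ?_
    rw [← turnsBelow_iff hc₁ hc₂ _ (Or.inl ⟨rfl, rfl⟩) hV hω ht hβ,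
      encard_events_eq_iff ξ ω t (Nat.succ_ne_zero _), maxPosition_lt_iff c₁ c₂ V₀ ξ ht]
  rw [measureReal_congr e, measureReal_def, h.indep_velocity.measure_inter_preimage_eq_mul _ _
    (measurableSet_singleton c₁) hB, ENNReal.toReal_mul]
  congr 1
  · have : P (V₀ ⁻¹' {c₁}) = 1 / 2 := h.prob_right
    rw [this]
    simp
  · exact real_turnsBelow_odd hc₁ hc₂ hlam k hξ ht hβ.le

theorem IsTelegraphInput.real_count_eq [IsProbabilityMeasure P]
    (h : IsTelegraphInput c₁ c₂ lam P V₀ ξ)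
    (hc₁ : 0 < c₁) (hc₂ : 0 < c₂) (hlam : 0 < lam) (k : ℕ) {t : ℝ} (ht : 0 ≤ t) :
    P.real {ω | V₀ ω = c₁ ∧ count ξ t ω = 2 * k + 1} =
      1 / 2 * ((lam / (c₁ + c₂)) ^ (2 * k + 1) * Real.exp (-(lam * t)) *
        dividedPow (2 * k + 1) ((c₁ + c₂) * t)) := by
  -- Any level above `c₁ * t` would do: no path reaches it, so the constraint on the maximum is
  -- void.
  have hβ : 0 < c₁ * t + 1 := by positivity
  have e := h.real_maxPosition_lt hc₁ hc₂ hlam k ht hβ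
  rw [Set.inter_eq_left.2, oddVolume, if_pos (by linarith)] at e
  · rw [e]
    congr 3
    ring
  · intro ω hω
    refine (maxPosition_lt_iff c₁ c₂ V₀ ξ ht ω _).2 fun s hs => ?_
    have h1 := position_le hc₁ hc₂ hω.1 ξ hs.1
    have h2 := mul_le_mul_of_nonneg_left hs.2 hc₁.le
    linarith

end

end Telegraph

theorem theorem2p2 {Ω : Type*} [MeasurableSpace Ω] (P : Measure Ω) [IsProbabilityMeasure P]
    (c₁ c₂ lam : ℝ) (hc₁ : 0 < c₁) (hc₂ : 0 < c₂) (hlam : 0 < lam)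
    (V₀ : Ω → ℝ) (ξ : ℕ → Ω → ℝ) (hinput : Telegraph.IsTelegraphInput c₁ c₂ lam P V₀ ξ)
    (t : ℝ) (ht : 0 < t) (k : ℕ) (β : ℝ) (hβ : β ∈ Set.Icc 0 (c₁ * t)) :
    (cond P {ω | V₀ ω = c₁ ∧ Telegraph.count ξ t ω = 2 * k + 1}).real
        {ω | Telegraph.maxPosition c₁ c₂ V₀ ξ t ω < β} =
      ∑ j ∈ Finset.range (k + 1), ((2 * k + 1).choose j : ℝ) *
        (((c₁ * t - β) ^ j * (c₂ * t + β) ^ (2 * k + 1 - j)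
            - (c₂ / c₁) ^ (2 * k + 1 - 2 * j) * (c₁ * t - β) ^ (2 * k + 1 - j) * (c₂ * t + β) ^ j)
          / ((c₁ + c₂) * t) ^ (2 * k + 1)) := by
  rw [Telegraph.sum_choose_eq_oddPoly]
  rcases hβ.1.eq_or_lt with rfl | hβ0
  -- For `β = 0` the path starts on the level, and the formula is evaluated on the line `y = ρx`;
  -- both sides are zero.
  · have hempty : {ω | Telegraph.maxPosition c₁ c₂ V₀ ξ t ω < 0} = ∅ := by
      ext ω
      simp only [Set.mem_ofPred_eq, Set.mem_empty_iff_false, iff_false,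
        Telegraph.maxPosition_lt_iff c₁ c₂ V₀ ξ ht.le]
      intro h
      simpa [Telegraph.position] using h 0 ⟨le_rfl, ht.le⟩
    have hy : c₂ * t + 0 = c₂ / c₁ * (c₁ * t - 0) := by
      field_simp
      ring
    rw [hempty, measureReal_empty, hy, Telegraph.oddPoly_mul_self]
    simp
  · have hA : MeasurableSet {ω | V₀ ω = c₁ ∧ Telegraph.count ξ t ω = 2 * k + 1} :=
      (hinput.measurable_velocity (measurableSet_singleton c₁)).inter
        (Telegraph.measurable_count hinput.measurable_waiting t
          (measurableSet_singleton (2 * k + 1)))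
    have h1 := hinput.real_maxPosition_lt hc₁ hc₂ hlam k ht.le hβ0
    have h2 := hinput.real_count_eq hc₁ hc₂ hlam k ht.le
    rw [measureReal_def, cond_apply hA, ENNReal.toReal_mul, ENNReal.toReal_inv, ← measureReal_def,
      ← measureReal_def, h1, h2, Telegraph.oddVolume_of_nonneg _ _ (by linarith [hβ.2])]
    have hC : (c₁ + c₂) * t ≠ 0 := by positivity
    rw [Telegraph.dividedPow]
    field_simp
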